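/- Let $n\ge 1$, $d\ge 17$ and $s$ be integers with $5\le s\le \frac{d-1}{4}+1$, and let $\lambda,\sigma>0$ be real numbers with $\lambda/\sigma\le 0.2$. For $\theta=(\mu_1,\mu_2)\in\mathbb{R}^d\times\mathbb{R}^d$ let $P_\theta$ be the distribution on $\mathbb{R}^d$ with density $$p_\theta(x)=\tfrac12 f(x;\mu_1,\sigma^2 I)+\tfrac12 f(x;\mu_2,\sigma^2 I),$$ where $f(\cdot;\mu,\sigma^2 I)$ is the density of $\mathcal N(\mu,\sigma^2 I)$, and let $$\Theta_{\lambda,s}=\{(\mu_1,\mu_2):\ \|\mu_1-\mu_2\|\ge\lambda,\ \|\mu_1-\mu_2\|_0\le s\},$$ where $\|\cdot\|$ is the Euclidean norm and $\|\cdot\|_0$ is the number of nonzero coordinates. Let $F_\theta(x)=\operatorname{argmax}_{i\in\{1,2\}} f(x;\mu_i,\sigma^2 I)$ be the Bayes optimal assignment, with ties assigned to the label $1$ (for $\mu_1\ne\mu_2$ ties have probability zero), and for $F:\mathbb{R}^d\to\{1,2\}$ let the clustering loss be $$L_\theta(F)=\min_\pi P_\theta\big(\{x: F_\theta(x)\ne\pi(F(x))\}\big),$$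 the minimum being over the two permutations $\pi$ of $\{1,2\}$. Then $$\inf_{\widehat F_n}\ \sup_{\theta\in\Theta_{\lambda,s}}\ \mathbb{E}_\theta L_\theta(\widehat F_n)\ \ge\ \frac1{600}\min\left\{\sqrt{\frac{8}{45}}\,\frac{\sigma^2}{\lambda^2}\sqrt{\frac{s-1}{n}\log\left(\frac{d-1}{s-1}\right)},\ \frac12\right\},$$ where the infimum is over all assignment functions $\widehat F_n:\mathbb{R}^d\to\{1,2\}$ learned from $n$ data points $X_1,\dots,X_n$ (that is, over all maps $(X_1,\dots,X_n,x)\mapsto \widehat F_n(x)\in\{1,2\}$ that are jointly measurable), and $\mathbb{E}_\theta$ is the expectation when $X_1,\dots,X_n$ are drawn i.i.d. from $P_\theta$. -/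

import Mathlib

open MeasureTheory
open scoped ENNReal

noncomputable section

namespace GaussMix

/-- The space `ℝ^d` with its Euclidean norm and Lebesgue measure. -/
abbrev E (d : ℕ) : Type := EuclideanSpace ℝ (Fin d)

/-- The density `f(·; μ, σ² I)` of the isotropic Gaussian `N(μ, σ² I)` on `ℝ^d`. -/
def gaussianDensity {d : ℕ} (σ : ℝ) (μ x : E d) : ℝ :=
  (Real.sqrt (2 * Real.pi * σ ^ 2))⁻¹ ^ d * Real.exp (-‖x - μ‖ ^ 2 / (2 * σ ^ 2))

/-- The density `p_θ` of the mixture with equal weights, `θ = (μ₁, μ₂)`. -/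
def mixtureDensity {d : ℕ} (σ : ℝ) (θ : E d × E d) (x : E d) : ℝ :=
  1 / 2 * gaussianDensity σ θ.1 x + 1 / 2 * gaussianDensity σ θ.2 x

/-- The measure `P_θ` with Lebesgue density `p_θ`. -/
def mixture {d : ℕ} (σ : ℝ) (θ : E d × E d) : Measure (E d) :=
  volume.withDensity fun x => ENNReal.ofReal (mixtureDensity σ θ x)

/-- The law of an i.i.d. sample `X₁, …, Xₙ` from `P_θ`. -/
def sampleLaw {d : ℕ} (σ : ℝ) (n : ℕ) (θ : E d × E d) : Measure (Fin n → E d) :=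
  Measure.pi fun _ => mixture σ θ

/-- The class `Θ_{λ,s}`: separation at least `lam`, and means that differ in at most `s`
coordinates (`hammingNorm` counts the nonzero coordinates). -/
def sparseClass (d : ℕ) (lam : ℝ) (s : ℕ) : Set (E d × E d) :=
  {θ | lam ≤ ‖θ.1 - θ.2‖ ∧ hammingNorm (θ.1 - θ.2).ofLp ≤ s}

/-- The Bayes optimal assignment `F_θ(x) = argmax_i f(x; μ_i, σ² I)`. The labels `1, 2` are the
elements `0, 1` of `Fin 2`; a tie goes to the first label. -/
def bayes {d : ℕ} (σ : ℝ) (θ : E d × E d) (x : E d) : Fin 2 :=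
  open Classical in
  if gaussianDensity σ θ.2 x ≤ gaussianDensity σ θ.1 x then 0 else 1

/-- The clustering loss `L_θ(F) = min_π P_θ {x | F_θ(x) ≠ π(F(x))}`. -/
def clusterLoss {d : ℕ} (σ : ℝ) (θ : E d × E d) (F : E d → Fin 2) : ℝ≥0∞ :=
  ⨅ τ : Equiv.Perm (Fin 2), mixture σ θ {x | bayes σ θ x ≠ τ (F x)}

/-- The expected loss `𝔼_θ L_θ(F̂ₙ)` of an assignment function learned from the data. -/
def expectedLoss {d : ℕ} (σ : ℝ) (n : ℕ) (θ : E d × E d)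
    (F : (Fin n → E d) → E d → Fin 2) : ℝ≥0∞ :=
  ∫⁻ X, clusterLoss σ θ (F X) ∂(sampleLaw σ n θ)

/-- The minimax expected loss over a class `Θ` of parameters; estimators are maps from the data
to assignment functions, jointly measurable in the data and in the point to be assigned. -/
def minimaxRisk {d : ℕ} (σ : ℝ) (n : ℕ) (Θ : Set (E d × E d)) : ℝ≥0∞ :=
  ⨅ (F : (Fin n → E d) → E d → Fin 2) (_ : Measurable (Function.uncurry F)),
    ⨆ θ ∈ Θ, expectedLoss σ n θ F

end GaussMix

end

noncomputable section

namespace GaussMix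

open ProbabilityTheory RealInnerProductSpace

/-! Only symmetric mixtures with means `±μ/2` are used. With `k = s - 1`, each `μ` has length `lam`,
one large fixed coordinate `i₀`, and a fraction `ε ^ 2` of its squared length spread evenly over a
`k`-subset `ω` of the other `d - 1` coordinates. The reference vector `ν` has all its length on
`i₀`.

Geometry: the Bayes rules are half-spaces through the origin. If `ω` and `ω'` share less than `3k/4`
elements, the rules differ with probability at least `ε/15` under `N(0, σ² I)`, even after
relabelling (`le_centredGaussian_bayes_ne`). Hence all patterns to which one learned rule is
`ε/30`-close overlap any one of them heavily. With `T = k log ((d - 1)/k)`, these form a fraction at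
most `exp (-T/4)` of all patterns (`card_large_overlap_le`, `sum_indicator_near_le`).

Information: the second moment of the likelihood ratio against the `ν`-mixture exceeds one by order
`(lam/σ)^4 ε ^ 2` (`lintegral_symmRatio_sq_le`). For the chosen `ε`, the `n`-sample second moment is
at most `exp (T/40)`.

Cauchy–Schwarz and averaging over `ω` (`exists_measure_le_of_card_le`) then give a pattern near
which the rule lands with probability at most `0.7`. Otherwise the loss is at least `ε/60`, since
the mixture density is at least half the centred Gaussian density. -/

/-! ### Product densities and change of measure for events. -/

lemma lintegral_pi_prod {ι α : Type*} [Fintype ι] [MeasurableSpace α] (ρ : Measure α)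
    [IsProbabilityMeasure ρ] (g : ι → α → ℝ≥0∞) (hg : ∀ i, Measurable (g i)) :
    ∫⁻ x, ∏ i, g i (x i) ∂(Measure.pi fun _ : ι => ρ) = ∏ i, ∫⁻ x, g i x ∂ρ := by
  have hind : iIndepFun (fun i (x : ι → α) => g i (x i)) (Measure.pi fun _ : ι => ρ) :=
    iIndepFun_pi (X := g) (fun i => (hg i).aemeasurable)
  rw [lintegral_prod_eq_prod_lintegral_of_indepFun Finset.univ _ hind
    (fun i => (hg i).comp (measurable_pi_apply i))]
  refine Finset.prod_congr rfl fun i _ => ?_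
  exact (measurePreserving_eval (fun _ : ι => ρ) i).lintegral_comp (hg i)

lemma pi_withDensity {ι α : Type*} [Fintype ι] [MeasurableSpace α] (ρ : Measure α)
    [IsProbabilityMeasure ρ] (g : α → ℝ≥0∞) (hg : Measurable g)
    [IsProbabilityMeasure (ρ.withDensity g)] :
    Measure.pi (fun _ : ι => ρ.withDensity g) =
      (Measure.pi fun _ : ι => ρ).withDensity fun x => ∏ i, g (x i) := by
  refine Measure.pi_eq fun s hs => ?_
  have hS : MeasurableSet (Set.univ.pi s) := MeasurableSet.univ_pi hs
  rw [withDensity_apply _ hS, ← lintegral_indicator hS]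
  have : (Set.univ.pi s).indicator (fun x : ι → α => ∏ i, g (x i)) =
      fun x => ∏ i, (s i).indicator g (x i) := by
    ext x
    by_cases hx : x ∈ Set.univ.pi s
    · rw [Set.indicator_of_mem hx]
      exact Finset.prod_congr rfl fun i _ => (Set.indicator_of_mem (hx i trivial) g).symm
    · rw [Set.indicator_of_notMem hx]
      simp only [Set.mem_univ_pi, not_forall] at hx
      obtain ⟨i, hi⟩ := hx
      exact (Finset.prod_eq_zero (Finset.mem_univ i) (Set.indicator_of_notMem hi g)).symm
  rw [this, lintegral_pi_prod ρ _ fun i => hg.indicator (hs i)]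
  exact Finset.prod_congr rfl fun i _ => by
    rw [lintegral_indicator (hs i), withDensity_apply _ (hs i)]

/-- Cauchy–Schwarz for `g` times the indicator of `A`. -/
lemma sq_withDensity_apply_le {α : Type*} [MeasurableSpace α] (ρ : Measure α) (g : α → ℝ≥0∞)
    (hg : Measurable g) {A : Set α} (hA : MeasurableSet A) :
    (ρ.withDensity g A) ^ 2 ≤ (∫⁻ x, g x ^ 2 ∂ρ) * ρ A := by
  have h := ENNReal.lintegral_mul_le_Lp_mul_Lq ρ Real.HolderConjugate.two_two
    hg.aemeasurable (measurable_const.indicator hA (f := fun _ => (1 : ℝ≥0∞))).aemeasurable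
  have e1 : ∫⁻ x, (g * A.indicator (fun _ => 1) : α → ℝ≥0∞) x ∂ρ = ρ.withDensity g A := by
    rw [withDensity_apply _ hA, ← lintegral_indicator hA]
    refine lintegral_congr fun x => ?_
    by_cases hx : x ∈ A <;> simp [hx]
  have e2 : ∫⁻ x, (A.indicator (fun _ => (1 : ℝ≥0∞)) x) ^ (2 : ℝ) ∂ρ = ρ A := by
    rw [← lintegral_indicator_one hA]
    refine lintegral_congr fun x => ?_
    by_cases hx : x ∈ A <;> simp [hx]
  rw [e1, e2] at h
  calc (ρ.withDensity g A) ^ 2 ≤ ((∫⁻ x, g x ^ (2 : ℝ) ∂ρ) ^ (1 / 2 : ℝ) * ρ A ^ (1 / 2 : ℝ)) ^ 2 := by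
        gcongr
    _ = _ := by
        rw [mul_pow, ← ENNReal.rpow_natCast, ← ENNReal.rpow_natCast, ← ENNReal.rpow_mul,
          ← ENNReal.rpow_mul]
        norm_num

lemma sq_pi_withDensity_apply_le {ι α : Type*} [Fintype ι] [MeasurableSpace α] (ρ : Measure α)
    [IsProbabilityMeasure ρ] (g : α → ℝ≥0∞) (hg : Measurable g)
    [IsProbabilityMeasure (ρ.withDensity g)] {A : Set (ι → α)} (hA : MeasurableSet A) :
    (Measure.pi (fun _ : ι => ρ.withDensity g) A) ^ 2 ≤
      (∫⁻ x, g x ^ 2 ∂ρ) ^ Fintype.card ι * Measure.pi (fun _ : ι => ρ) A := by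
  rw [pi_withDensity ρ g hg]
  refine (sq_withDensity_apply_le _ _ (by fun_prop) hA).trans_eq ?_
  congr 1
  simp_rw [← Finset.prod_pow]
  rw [lintegral_pi_prod ρ (fun _ x => g x ^ 2) fun _ => by fun_prop]
  simp

/-! ### Counting subsets with large overlap. -/

-- Union bound: such a `B` contains some `r`-subset `C` of `A`, and is determined by `C` and the
-- rest of `B` in `S \ C`.
open Finset in
lemma card_overlap_le {α : Type*} [DecidableEq α] (S A : Finset α) (hA : A ⊆ S) (r : ℕ) :
    #{B ∈ S.powersetCard #A | r ≤ #(B ∩ A)} ≤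
      (#A).choose r * (#S - r).choose (#A - r) := by
  classical
  have hsub : {B ∈ S.powersetCard #A | r ≤ #(B ∩ A)} ⊆
      (A.powersetCard r).biUnion fun C =>
        ((S \ C).powersetCard (#A - r)).image fun D => C ∪ D := by
    intro B hB
    simp only [mem_filter, mem_powersetCard] at hB
    obtain ⟨⟨hBS, hBc⟩, hBr⟩ := hB
    obtain ⟨C, hC, hCr⟩ := exists_subset_card_eq hBr
    simp only [mem_biUnion, mem_image, mem_powersetCard]
    have hCB : C ⊆ B := hC.trans inter_subset_left
    refine ⟨C, ⟨hC.trans inter_subset_right, hCr⟩, B \ C, ⟨sdiff_subset_sdiff hBS subset_rfl, ?_⟩,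
      union_sdiff_of_subset hCB⟩
    rw [card_sdiff_of_subset hCB, hBc, hCr]
  refine (card_le_card hsub).trans (card_biUnion_le.trans ?_)
  calc ∑ C ∈ A.powersetCard r, #(((S \ C).powersetCard (#A - r)).image fun D => C ∪ D)
      ≤ ∑ C ∈ A.powersetCard r, (#S - r).choose (#A - r) := by
        refine sum_le_sum fun C hC => card_image_le.trans ?_
        rw [mem_powersetCard] at hC
        rw [card_powersetCard, card_sdiff_of_subset (hC.1.trans hA), hC.2]
    _ = _ := by simp

lemma pow_mul_descFactorial_le {m k : ℕ} (hkm : k ≤ m) (r : ℕ) :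
    m ^ r * k.descFactorial r ≤ k ^ r * m.descFactorial r := by
  induction r with
  | zero => simp
  | succ r ih =>
    rw [pow_succ, pow_succ, Nat.descFactorial_succ, Nat.descFactorial_succ]
    have : m * (k - r) ≤ k * (m - r) := by
      rw [Nat.mul_sub, Nat.mul_sub, mul_comm m k]
      exact Nat.sub_le_sub_left (Nat.mul_le_mul_right _ hkm) _
    calc m ^ r * m * ((k - r) * k.descFactorial r)
        = (m ^ r * k.descFactorial r) * (m * (k - r)) := by ring
      _ ≤ (k ^ r * m.descFactorial r) * (k * (m - r)) := Nat.mul_le_mul ih this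
      _ = _ := by ring

/-- A random `k`-subset of `m` points contains `r` given points with probability at most `(k/m) ^
r`. -/
lemma pow_mul_choose_sub_le {m k r : ℕ} (hkm : k ≤ m) (hrk : r ≤ k) :
    m ^ r * (m - r).choose (k - r) ≤ k ^ r * m.choose k := by
  have h1 := Nat.choose_mul (n := m) hrk
  have h2 := pow_mul_descFactorial_le hkm r
  rw [Nat.descFactorial_eq_factorial_mul_choose, Nat.descFactorial_eq_factorial_mul_choose] at h2
  have h3 : m ^ r * k.choose r ≤ k ^ r * m.choose r := by
    refine Nat.le_of_mul_le_mul_left ?_ (Nat.factorial_pos r)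
    linarith
  refine Nat.le_of_mul_le_mul_right (c := m.choose r) ?_ (Nat.choose_pos (hrk.trans hkm))
  calc m ^ r * (m - r).choose (k - r) * m.choose r
      = m ^ r * (m.choose r * (m - r).choose (k - r)) := by ring
    _ = (m ^ r * k.choose r) * m.choose k := by rw [← h1]; ring
    _ ≤ (k ^ r * m.choose r) * m.choose k := Nat.mul_le_mul_right _ h3
    _ = _ := by ring

open Finset in
lemma card_large_overlap_le {α : Type*} [DecidableEq α] (S A : Finset α) (hA : A ⊆ S)
    (hpos : 0 < #A) (h4 : 4 * #A ≤ #S) :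
    (#{B ∈ S.powersetCard #A | 3 * #A ≤ 4 * #(B ∩ A)} : ℝ) ≤
      Real.exp (-((#A : ℝ) * Real.log (#S / #A)) / 4) * #(S.powersetCard #A) := by
  set k := #A
  set m := #S
  -- The ceiling of `3k/4`.
  set r := (3 * k + 3) / 4 with hr
  have hrk : r ≤ k := by omega
  have hkm : k ≤ m := by omega
  have hfil : {B ∈ S.powersetCard k | 3 * k ≤ 4 * #(B ∩ A)} =
      {B ∈ S.powersetCard k | r ≤ #(B ∩ A)} := by
    refine filter_congr fun B _ => ?_
    omega
  have h1 := card_overlap_le S A hA r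
  have h2 := pow_mul_choose_sub_le hkm hrk
  have hk0 : (0 : ℝ) < k := by exact_mod_cast hpos
  have hm0 : (0 : ℝ) < m := by exact_mod_cast hpos.trans_le hkm
  set q : ℝ := m / k with hq
  have hq4 : 4 ≤ q := by
    rw [hq, le_div_iff₀ hk0]; exact_mod_cast h4
  have hq0 : 0 < q := by linarith
  have hlog : 2 * Real.log 2 ≤ Real.log q := by
    rw [show 2 * Real.log 2 = Real.log 4 by
      rw [show (4 : ℝ) = 2 ^ 2 by norm_num, Real.log_pow]; norm_num]
    exact Real.log_le_log (by norm_num) hq4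
  have hlog0 : 0 ≤ Real.log q := Real.log_nonneg (by linarith)
  have h3 : ((m - r).choose (k - r) : ℝ) ≤ q⁻¹ ^ r * m.choose k := by
    have : (m : ℝ) ^ r * (m - r).choose (k - r) ≤ (k : ℝ) ^ r * m.choose k := by exact_mod_cast h2
    rw [hq, inv_div, div_pow, div_mul_eq_mul_div, le_div_iff₀ (by positivity)]
    linarith
  have h4 : (k.choose r : ℝ) ≤ 2 ^ k := by
    exact_mod_cast Nat.choose_le_two_pow k r
  rw [hfil, card_powersetCard]
  have h5 : (2 : ℝ) ^ k * q⁻¹ ^ r ≤ Real.exp (-((k : ℝ) * Real.log q) / 4) := by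
    have e1 : (2 : ℝ) ^ k = Real.exp (k * Real.log 2) := by
      rw [mul_comm, Real.exp_mul, Real.exp_log (by norm_num), Real.rpow_natCast]
    have e2 : q⁻¹ ^ r = Real.exp (-(r * Real.log q)) := by
      rw [Real.exp_neg, mul_comm, Real.exp_mul, Real.exp_log hq0, Real.rpow_natCast, inv_pow]
    -- Since `q ≥ 4`, `log 2 ≤ (log q)/2`; so `2 ^ k` costs at most half of `k log q`, against the
    -- gain of three quarters.
    rw [e1, e2, ← Real.exp_add, Real.exp_le_exp]
    have hr' : (3 * k : ℝ) ≤ 4 * r := by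
      have : 3 * k ≤ 4 * r := by omega
      exact_mod_cast this
    nlinarith [mul_le_mul_of_nonneg_right hr' hlog0, mul_le_mul_of_nonneg_left hlog hk0.le]
  calc (#{B ∈ S.powersetCard k | r ≤ #(B ∩ A)} : ℝ)
      ≤ k.choose r * (m - r).choose (k - r) := by exact_mod_cast h1
    _ ≤ 2 ^ k * (q⁻¹ ^ r * m.choose k) := by gcongr
    _ = (2 ^ k * q⁻¹ ^ r) * m.choose k := by ring
    _ ≤ _ := by gcongr

/-! ### Gaussian probabilities of slabs and double cones. -/

lemma le_gaussianReal_Ioo {t : ℝ} (ht0 : 0 ≤ t) (ht1 : t ≤ 1) :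
    ENNReal.ofReal (0.348 * t) ≤ gaussianReal 0 1 (Set.Ioo (-(t / 2)) (t / 2)) := by
  rw [gaussianReal_apply _ one_ne_zero]
  have hvol : ENNReal.ofReal (0.348 * t) =
      ∫⁻ _ in Set.Ioo (-(t / 2)) (t / 2), ENNReal.ofReal 0.348 := by
    rw [setLIntegral_const, Real.volume_Ioo, ← ENNReal.ofReal_mul (by norm_num)]
    congr 1; ring
  rw [hvol]
  refine setLIntegral_mono (measurable_gaussianPDF 0 1) fun x hx => ?_
  rw [gaussianPDF]
  refine ENNReal.ofReal_le_ofReal ?_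
  rw [gaussianPDFReal]
  have h1 : (1 / 2.51 : ℝ) ≤ (√(2 * Real.pi * ((1 : NNReal) : ℝ)))⁻¹ := by
    rw [← one_div]
    refine one_div_le_one_div_of_le (by positivity) ?_
    rw [Real.sqrt_le_left (by norm_num)]
    have := Real.pi_lt_d2
    norm_num; linarith
  have h2 : (7 / 8 : ℝ) ≤ Real.exp (-(x - 0) ^ 2 / (2 * ((1 : NNReal) : ℝ))) := by
    refine le_trans ?_ (Real.add_one_le_exp _)
    have : x ^ 2 ≤ 1 / 4 := by
      nlinarith [hx.1, hx.2]
    norm_num; linarith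
  calc (0.348 : ℝ) ≤ (1 / 2.51) * (7 / 8) := by norm_num
    _ ≤ _ := by gcongr

lemma le_gaussianReal_compl_Icc :
    ENNReal.ofReal 0.6 ≤ gaussianReal 0 1 (Set.Icc (-(1 / 2)) (1 / 2))ᶜ := by
  rw [prob_compl_eq_one_sub measurableSet_Icc]
  have h : gaussianReal 0 1 (Set.Icc (-(1 / 2)) (1 / 2)) ≤ ENNReal.ofReal 0.4 := by
    rw [gaussianReal_apply _ one_ne_zero]
    have hvol : ENNReal.ofReal 0.4 = ∫⁻ _ in Set.Icc (-(1 / 2) : ℝ) (1 / 2), ENNReal.ofReal 0.4 := by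
      rw [setLIntegral_const, Real.volume_Icc, ← ENNReal.ofReal_mul (by norm_num)]
      norm_num
    rw [hvol]
    refine setLIntegral_mono measurable_const fun x hx => ?_
    rw [gaussianPDF]
    refine ENNReal.ofReal_le_ofReal ?_
    rw [gaussianPDFReal]
    have h1 : (√(2 * Real.pi * ((1 : NNReal) : ℝ)))⁻¹ ≤ (1 / 2.5 : ℝ) := by
      rw [← one_div]
      refine one_div_le_one_div_of_le (by norm_num) ?_
      refine Real.le_sqrt_of_sq_le ?_
      have := Real.pi_gt_d2
      norm_num; linarith
    have h2 : Real.exp (-(x - 0) ^ 2 / (2 * ((1 : NNReal) : ℝ))) ≤ 1 := by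
      rw [Real.exp_le_one_iff]
      exact div_nonpos_of_nonpos_of_nonneg (by nlinarith [sq_nonneg (x - 0)]) (by positivity)
    calc _ ≤ (1 / 2.5 : ℝ) * 1 := by gcongr
      _ = _ := by norm_num
  calc ENNReal.ofReal 0.6 = 1 - ENNReal.ofReal 0.4 := by
        rw [← ENNReal.ofReal_one, ← ENNReal.ofReal_sub _ (by norm_num)]; norm_num
    _ ≤ _ := by gcongr

section StdGaussian

variable {V : Type*} [NormedAddCommGroup V] [InnerProductSpace ℝ V] [FiniteDimensional ℝ V]
  [MeasurableSpace V] [BorelSpace V]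

lemma stdGaussian_map_inner {e : V} (he : ‖e‖ = 1) :
    (stdGaussian V).map (fun x => ⟪e, x⟫) = gaussianReal 0 1 := by
  have h := IsGaussian.map_eq_gaussianReal (μ := stdGaussian V) (innerSL ℝ e)
  rw [integral_strongDual_stdGaussian, variance_dual_stdGaussian, innerSL_apply_norm, he] at h
  simpa using h

lemma stdGaussian_indepFun_inner {a b : V} (hab : ⟪a, b⟫ = 0) :
    IndepFun (fun x => ⟪a, x⟫) (fun x => ⟪b, x⟫) (stdGaussian V) := by
  have hG : HasGaussianLaw (fun x : V => (⟪a, x⟫, ⟪b, x⟫)) (stdGaussian V) :=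
    (IsGaussian.hasGaussianLaw_id (μ := stdGaussian V)).map_fun
      ((innerSL ℝ a).prod (innerSL ℝ b))
  refine hG.indepFun_of_covariance_eq_zero ?_
  rw [← covarianceBilin_apply_eq_cov IsGaussian.memLp_two_id, covarianceBilin_stdGaussian]
  exact hab

/-- Orthogonality makes the two normalised projections independent standard normals. It suffices
that the first is below `t/2` and the second above `1/2` in absolute value, and `0.348 * 0.6 > 1/5`.
-/
lemma le_stdGaussian_abs_inner_lt {a b : V} (ha : a ≠ 0) (hb : b ≠ 0) (hab : ⟪a, b⟫ = 0)
    {t : ℝ} (ht0 : 0 < t) (ht1 : t ≤ 1) (hle : t * ‖a‖ ≤ ‖b‖) :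
    ENNReal.ofReal (t / 5) ≤ stdGaussian V {x | |⟪a, x⟫| < |⟪b, x⟫|} := by
  have ha' : 0 < ‖a‖ := norm_pos_iff.2 ha
  have hb' : 0 < ‖b‖ := norm_pos_iff.2 hb
  set e : V := ‖a‖⁻¹ • a
  set f : V := ‖b‖⁻¹ • b
  have he : ‖e‖ = 1 := norm_smul_inv_norm ha
  have hf : ‖f‖ = 1 := norm_smul_inv_norm hb
  have hae : ∀ x, ⟪a, x⟫ = ‖a‖ * ⟪e, x⟫ := fun x => by
    rw [real_inner_smul_left]; field_simp
  have hbf : ∀ x, ⟪b, x⟫ = ‖b‖ * ⟪f, x⟫ := fun x => by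
    rw [real_inner_smul_left]; field_simp
  have hef : ⟪e, f⟫ = 0 := by
    rw [real_inner_smul_left, real_inner_smul_right, hab]; simp
  have hsub : (fun x => ⟪e, x⟫) ⁻¹' Set.Ioo (-(t / 2)) (t / 2) ∩
      (fun x => ⟪f, x⟫) ⁻¹' (Set.Icc (-(1 / 2)) (1 / 2))ᶜ ⊆ {x | |⟪a, x⟫| < |⟪b, x⟫|} := by
    rintro x ⟨h1, h2⟩
    simp only [Set.mem_preimage, Set.mem_Ioo, ← abs_lt] at h1
    simp only [Set.mem_preimage, Set.mem_compl_iff, Set.mem_Icc, ← abs_le, not_le] at h2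
    simp only [Set.mem_ofPred_eq, hae, hbf, abs_mul, abs_norm]
    nlinarith [mul_lt_mul_of_pos_left h1 ha', mul_lt_mul_of_pos_left h2 hb']
  refine le_trans ?_ (measure_mono hsub)
  rw [(stdGaussian_indepFun_inner hef).measure_inter_preimage_eq_mul _ _ measurableSet_Ioo
    measurableSet_Icc.compl, ← Measure.map_apply (by fun_prop) measurableSet_Ioo,
    ← Measure.map_apply (by fun_prop) measurableSet_Icc.compl, stdGaussian_map_inner he,
    stdGaussian_map_inner hf]
  calc ENNReal.ofReal (t / 5) ≤ ENNReal.ofReal (0.348 * t) * ENNReal.ofReal 0.6 := by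
        rw [← ENNReal.ofReal_mul (by positivity)]
        exact ENNReal.ofReal_le_ofReal (by linarith)
    _ ≤ _ := mul_le_mul' (le_gaussianReal_Ioo ht0.le ht1) le_gaussianReal_compl_Icc

end StdGaussian

/-- The centred isotropic Gaussian `N(0, σ² I)`. -/
def centredGaussian (d : ℕ) (σ : ℝ) : Measure (E d) := (stdGaussian (E d)).map fun x => σ • x

instance (d : ℕ) (σ : ℝ) : IsProbabilityMeasure (centredGaussian d σ) :=
  Measure.isProbabilityMeasure_map (by fun_prop)

lemma le_centredGaussian_abs_inner_lt {d : ℕ} {σ : ℝ} (hσ : 0 < σ) {a b : E d} (ha : a ≠ 0)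
    (hb : b ≠ 0) (hab : ⟪a, b⟫ = 0) {t : ℝ} (ht0 : 0 < t) (ht1 : t ≤ 1) (hle : t * ‖a‖ ≤ ‖b‖) :
    ENNReal.ofReal (t / 5) ≤ centredGaussian d σ {x | |⟪a, x⟫| < |⟪b, x⟫|} := by
  refine (le_stdGaussian_abs_inner_lt ha hb hab ht0 ht1 hle).trans_eq ?_
  rw [centredGaussian, Measure.map_apply (by fun_prop)
    (measurableSet_lt (by fun_prop) (by fun_prop))]
  congr 1
  ext x
  simp only [Set.mem_preimage, Set.mem_ofPred_eq, real_inner_smul_right, abs_mul]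
  rw [mul_lt_mul_iff_right₀ (abs_pos.2 hσ.ne')]

lemma charFun_centredGaussian {d : ℕ} (σ : ℝ) (w : E d) :
    charFun (centredGaussian d σ) w = Complex.exp (-(σ ^ 2 * ‖w‖ ^ 2) / 2) := by
  rw [centredGaussian, charFun_map_smul, charFun_stdGaussian, norm_smul]
  congr 1
  push_cast
  rw [mul_pow, Real.norm_eq_abs, ← Complex.ofReal_pow |σ|, sq_abs, Complex.ofReal_pow]

/-! ### The explicit Gaussian density and its exponential moments. -/

section Density

variable {d : ℕ} {σ : ℝ}

lemma gaussianDensity_nonneg (σ : ℝ) (μ x : E d) : 0 ≤ gaussianDensity σ μ x := by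
  unfold gaussianDensity; positivity

lemma measurable_gaussianDensity (σ : ℝ) (μ : E d) : Measurable (gaussianDensity σ μ) := by
  unfold gaussianDensity; fun_prop

/-- A complex `c` covers both the Laplace transform (`c = 1`) and the characteristic function (`c =
I`). -/
lemma integral_gaussianDensity_mul_cexp (hσ : 0 < σ) (c : ℂ) (w : E d) :
    ∫ x, (gaussianDensity σ 0 x : ℂ) * Complex.exp (c * (⟪w, x⟫ : ℝ)) =
      Complex.exp (c ^ 2 * σ ^ 2 * ‖w‖ ^ 2 / 2) := by
  have hb : 0 < ((1 / (2 * σ ^ 2) : ℝ) : ℂ).re := by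
    rw [Complex.ofReal_re]; positivity
  have h := GaussianFourier.integral_cexp_neg_mul_sq_norm_add hb c w
  have hσ' : (σ : ℂ) ≠ 0 := by exact_mod_cast hσ.ne'
  have hint : ∀ x : E d, (gaussianDensity σ 0 x : ℂ) * Complex.exp (c * (⟪w, x⟫ : ℝ)) =
      (((√(2 * Real.pi * σ ^ 2))⁻¹ ^ d : ℝ) : ℂ) *
        Complex.exp (-((1 / (2 * σ ^ 2) : ℝ) : ℂ) * ‖x‖ ^ 2 + c * (⟪w, x⟫ : ℝ)) := by
    intro x
    rw [gaussianDensity, sub_zero, Complex.exp_add, Complex.ofReal_mul, mul_assoc]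
    congr 2
    push_cast
    congr 1
    field_simp
  simp_rw [hint]
  rw [integral_const_mul, h, finrank_euclideanSpace_fin]
  have hpi : ((Real.pi : ℂ) / ((1 / (2 * σ ^ 2) : ℝ) : ℂ)) = ((2 * Real.pi * σ ^ 2 : ℝ) : ℂ) := by
    push_cast; field_simp
  have hpow : ((2 * Real.pi * σ ^ 2 : ℝ) : ℂ) ^ ((d : ℂ) / 2) =
      (((√(2 * Real.pi * σ ^ 2)) ^ d : ℝ) : ℂ) := by
    rw [show ((d : ℂ) / 2) = ((d / 2 : ℝ) : ℂ) by push_cast; rfl,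
      ← Complex.ofReal_cpow (by positivity), Real.sqrt_eq_rpow, ← Real.rpow_mul_natCast
        (by positivity)]
    congr 2
    ring
  rw [hpi, hpow, ← mul_assoc, ← Complex.ofReal_mul, ← mul_pow, inv_mul_cancel₀ (by positivity)]
  simp only [one_pow, Complex.ofReal_one, one_mul]
  congr 1
  push_cast
  field_simp
  ring

lemma integral_gaussianDensity_mul_exp (hσ : 0 < σ) (w : E d) :
    ∫ x, gaussianDensity σ 0 x * Real.exp ⟪w, x⟫ = Real.exp (σ ^ 2 * ‖w‖ ^ 2 / 2) := by
  have h := integral_gaussianDensity_mul_cexp hσ 1 w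
  have e : ∀ x : E d, (gaussianDensity σ 0 x : ℂ) * Complex.exp (1 * (⟪w, x⟫ : ℝ)) =
      ((gaussianDensity σ 0 x * Real.exp ⟪w, x⟫ : ℝ) : ℂ) := fun x => by
    push_cast; rw [one_mul]
  simp_rw [e] at h
  rw [integral_complex_ofReal] at h
  apply Complex.ofReal_injective
  rw [h]
  push_cast
  ring_nf

lemma integrable_gaussianDensity_mul_exp (hσ : 0 < σ) (w : E d) :
    Integrable fun x => gaussianDensity σ 0 x * Real.exp ⟪w, x⟫ := by
  by_contra h
  have := integral_gaussianDensity_mul_exp hσ w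
  -- A nonintegrable function has integral zero by convention, but this integral is positive.
  rw [integral_undef h] at this
  exact (Real.exp_pos _).ne this

lemma withDensity_gaussianDensity (hσ : 0 < σ) :
    (volume.withDensity fun x => ENNReal.ofReal (gaussianDensity σ (0 : E d) x)) =
      centredGaussian d σ := by
  have hint : Integrable (gaussianDensity σ (0 : E d)) := by
    simpa using integrable_gaussianDensity_mul_exp hσ (0 : E d)
  have : IsFiniteMeasure
      (volume.withDensity fun x => ENNReal.ofReal (gaussianDensity σ (0 : E d) x)) :=
    isFiniteMeasure_withDensity_ofReal hint.2
  refine Measure.ext_of_charFun ?_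
  ext w
  rw [charFun_centredGaussian, charFun_apply, integral_withDensity_eq_integral_toReal_smul
    (measurable_gaussianDensity σ 0).ennreal_ofReal (by simp)]
  have h := integral_gaussianDensity_mul_cexp hσ Complex.I w
  rw [show -((σ : ℂ) ^ 2 * (‖w‖ : ℂ) ^ 2) / 2 = Complex.I ^ 2 * σ ^ 2 * ‖w‖ ^ 2 / 2 by
    rw [Complex.I_sq]; ring, ← h]
  refine integral_congr_ae (.of_forall fun x => ?_)
  simp only [ENNReal.toReal_ofReal (gaussianDensity_nonneg σ 0 x), Complex.real_smul,
    real_inner_comm, mul_comm Complex.I]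

lemma integral_exp_inner_centredGaussian (hσ : 0 < σ) (w : E d) :
    ∫ x, Real.exp ⟪w, x⟫ ∂(centredGaussian d σ) = Real.exp (σ ^ 2 * ‖w‖ ^ 2 / 2) := by
  rw [← withDensity_gaussianDensity hσ, integral_withDensity_eq_integral_toReal_smul
    (measurable_gaussianDensity σ 0).ennreal_ofReal (by simp),
    ← integral_gaussianDensity_mul_exp hσ w]
  refine integral_congr_ae (.of_forall fun x => ?_)
  simp only [ENNReal.toReal_ofReal (gaussianDensity_nonneg σ 0 x), smul_eq_mul]

lemma integrable_exp_inner_centredGaussian (hσ : 0 < σ) (w : E d) :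
    Integrable (fun x => Real.exp ⟪w, x⟫) (centredGaussian d σ) := by
  by_contra h
  have := integral_exp_inner_centredGaussian hσ w
  rw [integral_undef h] at this
  exact (Real.exp_pos _).ne this

lemma integrable_cosh_inner_centredGaussian (hσ : 0 < σ) (w : E d) :
    Integrable (fun x => Real.cosh ⟪w, x⟫) (centredGaussian d σ) := by
  simp_rw [Real.cosh_eq, ← inner_neg_left]
  exact ((integrable_exp_inner_centredGaussian hσ w).add
    (integrable_exp_inner_centredGaussian hσ (-w))).div_const 2

lemma integral_cosh_inner_centredGaussian (hσ : 0 < σ) (w : E d) :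
    ∫ x, Real.cosh ⟪w, x⟫ ∂(centredGaussian d σ) = Real.exp (σ ^ 2 * ‖w‖ ^ 2 / 2) := by
  simp_rw [Real.cosh_eq, ← inner_neg_left]
  rw [integral_div, integral_add (integrable_exp_inner_centredGaussian hσ w)
    (integrable_exp_inner_centredGaussian hσ (-w)), integral_exp_inner_centredGaussian hσ,
    integral_exp_inner_centredGaussian hσ, norm_neg]
  ring

end Density

/-- The density of the symmetric mixture with means `± μ / 2` relative to `N(0, σ² I)`. -/
def symmLR {d : ℕ} (σ : ℝ) (μ x : E d) : ℝ :=
  Real.exp (-‖μ‖ ^ 2 / (8 * σ ^ 2)) * Real.cosh ⟪(1 / (2 * σ ^ 2)) • μ, x⟫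

/-- The parameter of the symmetric mixture with means `± μ / 2`. -/
def symmParam {d : ℕ} (μ : E d) : E d × E d := ((1 / 2 : ℝ) • μ, -((1 / 2 : ℝ) • μ))

/-! ### Symmetric mixtures and their likelihood ratios. -/

section Symm

variable {d : ℕ} {σ : ℝ}

lemma symmLR_pos (σ : ℝ) (μ x : E d) : 0 < symmLR σ μ x :=
  mul_pos (Real.exp_pos _) (Real.cosh_pos _)

lemma measurable_symmLR (σ : ℝ) (μ : E d) : Measurable (symmLR σ μ) := by
  unfold symmLR; fun_prop

lemma mixtureDensity_symmParam (hσ : 0 < σ) (μ x : E d) :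
    mixtureDensity σ (symmParam μ) x = gaussianDensity σ 0 x * symmLR σ μ x := by
  have h1 : -‖x - (1 / 2 : ℝ) • μ‖ ^ 2 / (2 * σ ^ 2) = -‖x - 0‖ ^ 2 / (2 * σ ^ 2) +
      (-‖μ‖ ^ 2 / (8 * σ ^ 2) + ⟪(1 / (2 * σ ^ 2)) • μ, x⟫) := by
    rw [norm_sub_sq_real, norm_smul, real_inner_smul_left, real_inner_smul_right, sub_zero,
      real_inner_comm]
    norm_num
    field_simp
    ring
  have h2 : -‖x - -((1 / 2 : ℝ) • μ)‖ ^ 2 / (2 * σ ^ 2) = -‖x - 0‖ ^ 2 / (2 * σ ^ 2) +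
      (-‖μ‖ ^ 2 / (8 * σ ^ 2) + -⟪(1 / (2 * σ ^ 2)) • μ, x⟫) := by
    rw [sub_neg_eq_add, norm_add_sq_real, norm_smul, real_inner_smul_left, real_inner_smul_right,
      sub_zero, real_inner_comm]
    norm_num
    field_simp
    ring
  simp only [mixtureDensity, symmParam, gaussianDensity, symmLR, h1, h2, Real.exp_add,
    Real.cosh_eq]
  ring

lemma mixture_symmParam (hσ : 0 < σ) (μ : E d) :
    mixture σ (symmParam μ) =
      (centredGaussian d σ).withDensity fun x => ENNReal.ofReal (symmLR σ μ x) := by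
  rw [← withDensity_gaussianDensity hσ, ← withDensity_mul _
    (measurable_gaussianDensity σ 0).ennreal_ofReal (measurable_symmLR σ μ).ennreal_ofReal, mixture]
  congr 1
  ext x
  rw [mixtureDensity_symmParam hσ, Pi.mul_apply, ENNReal.ofReal_mul (gaussianDensity_nonneg _ _ _)]

lemma integrable_symmLR (hσ : 0 < σ) (μ : E d) :
    Integrable (symmLR σ μ) (centredGaussian d σ) :=
  (integrable_cosh_inner_centredGaussian hσ _).const_mul _

lemma integral_symmLR (hσ : 0 < σ) (μ : E d) :
    ∫ x, symmLR σ μ x ∂(centredGaussian d σ) = 1 := by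
  unfold symmLR
  rw [integral_const_mul, integral_cosh_inner_centredGaussian hσ, ← Real.exp_add, norm_smul,
    Real.exp_eq_one_iff, Real.norm_of_nonneg (by positivity)]
  field_simp
  ring

lemma isProbabilityMeasure_mixture_symmParam (hσ : 0 < σ) (μ : E d) :
    IsProbabilityMeasure (mixture σ (symmParam μ)) := by
  rw [mixture_symmParam hσ]
  refine ⟨?_⟩
  rw [withDensity_apply _ MeasurableSet.univ, Measure.restrict_univ,
    ← ofReal_integral_eq_lintegral_ofReal (integrable_symmLR hσ μ)
    (.of_forall fun x => (symmLR_pos σ μ x).le), integral_symmLR hσ, ENNReal.ofReal_one]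

lemma symmLR_mul_symmLR (μ ν x : E d) :
    symmLR σ μ x * symmLR σ ν x = Real.exp (-(‖μ‖ ^ 2 + ‖ν‖ ^ 2) / (8 * σ ^ 2)) / 2 *
      (Real.cosh ⟪(1 / (2 * σ ^ 2)) • (μ + ν), x⟫ +
        Real.cosh ⟪(1 / (2 * σ ^ 2)) • (μ - ν), x⟫) := by
  simp only [symmLR, smul_add, smul_sub, inner_add_left, inner_sub_left, Real.cosh_add,
    Real.cosh_sub, neg_add, add_div, Real.exp_add]
  ring

lemma integrable_symmLR_mul_symmLR (hσ : 0 < σ) (μ ν : E d) :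
    Integrable (fun x => symmLR σ μ x * symmLR σ ν x) (centredGaussian d σ) := by
  simp_rw [symmLR_mul_symmLR]
  exact ((integrable_cosh_inner_centredGaussian hσ _).add
    (integrable_cosh_inner_centredGaussian hσ _)).const_mul _

/-- The product is a sum of hyperbolic cosines at `μ ± ν`. Their Gaussian integrals cancel the norm
prefactor, leaving only the cross term. -/
lemma integral_symmLR_mul_symmLR (hσ : 0 < σ) (μ ν : E d) :
    ∫ x, symmLR σ μ x * symmLR σ ν x ∂(centredGaussian d σ) =
      Real.cosh (⟪μ, ν⟫ / (4 * σ ^ 2)) := by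
  simp_rw [symmLR_mul_symmLR]
  rw [integral_const_mul, integral_add (integrable_cosh_inner_centredGaussian hσ _)
    (integrable_cosh_inner_centredGaussian hσ _), integral_cosh_inner_centredGaussian hσ,
    integral_cosh_inner_centredGaussian hσ, norm_smul, norm_smul, mul_pow, mul_pow,
    norm_add_sq_real, norm_sub_sq_real, Real.norm_of_nonneg (by positivity)]
  have h1 : σ ^ 2 * ((1 / (2 * σ ^ 2)) ^ 2 * (‖μ‖ ^ 2 + 2 * ⟪μ, ν⟫ + ‖ν‖ ^ 2)) / 2 =
      (‖μ‖ ^ 2 + ‖ν‖ ^ 2) / (8 * σ ^ 2) + ⟪μ, ν⟫ / (4 * σ ^ 2) := by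
    field_simp; ring
  have h2 : σ ^ 2 * ((1 / (2 * σ ^ 2)) ^ 2 * (‖μ‖ ^ 2 - 2 * ⟪μ, ν⟫ + ‖ν‖ ^ 2)) / 2 =
      (‖μ‖ ^ 2 + ‖ν‖ ^ 2) / (8 * σ ^ 2) + -(⟪μ, ν⟫ / (4 * σ ^ 2)) := by
    field_simp; ring
  rw [h1, h2, Real.exp_add, Real.exp_add, Real.cosh_eq, neg_div, Real.exp_neg]
  field_simp

lemma half_le_symmLR {μ : E d} (hμ : ‖μ‖ ^ 2 ≤ 4 * σ ^ 2) (x : E d) : 1 / 2 ≤ symmLR σ μ x := by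
  have h1 : (1 / 2 : ℝ) ≤ Real.exp (-‖μ‖ ^ 2 / (8 * σ ^ 2)) := by
    refine le_trans ?_ (Real.add_one_le_exp _)
    have : ‖μ‖ ^ 2 / (8 * σ ^ 2) ≤ 1 / 2 := div_le_of_le_mul₀ (by positivity) (by norm_num)
      (by linarith)
    rw [neg_div]; linarith
  calc (1 / 2 : ℝ) = 1 / 2 * 1 := by norm_num
    _ ≤ _ := mul_le_mul h1 (Real.one_le_cosh _) zero_le_one (Real.exp_pos _).le

lemma half_mul_centredGaussian_le (hσ : 0 < σ) {μ : E d} (hμ : ‖μ‖ ^ 2 ≤ 4 * σ ^ 2)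
    {A : Set (E d)} (hA : MeasurableSet A) :
    ENNReal.ofReal (1 / 2) * centredGaussian d σ A ≤ mixture σ (symmParam μ) A := by
  rw [mixture_symmParam hσ, withDensity_apply _ hA, ← setLIntegral_const]
  exact setLIntegral_mono (measurable_symmLR σ μ).ennreal_ofReal fun x _ =>
    ENNReal.ofReal_le_ofReal (half_le_symmLR hμ x)

/-- The density of one symmetric mixture relative to another. -/
def symmRatio (σ : ℝ) (ν μ x : E d) : ℝ≥0∞ := ENNReal.ofReal (symmLR σ μ x / symmLR σ ν x)

lemma measurable_symmRatio (σ : ℝ) (ν μ : E d) : Measurable (symmRatio σ ν μ) :=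
  ((measurable_symmLR σ μ).div (measurable_symmLR σ ν)).ennreal_ofReal

lemma mixture_withDensity_symmRatio (hσ : 0 < σ) (ν μ : E d) :
    (mixture σ (symmParam ν)).withDensity (symmRatio σ ν μ) = mixture σ (symmParam μ) := by
  rw [mixture_symmParam hσ, mixture_symmParam hσ, ← withDensity_mul _
    (measurable_symmLR σ ν).ennreal_ofReal (measurable_symmRatio σ ν μ)]
  congr 1
  ext x
  rw [Pi.mul_apply, symmRatio, ← ENNReal.ofReal_mul (symmLR_pos σ ν x).le,
    mul_div_cancel₀ _ (symmLR_pos σ ν x).ne']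

/-- With `a`, `b` the two densities relative to the Gaussian, `a²/b = (a - b)²/b + 2a - b`, and `b ≥
1/2` replaces `1/b` by `2`. Equal norms make the difference small when `μ` is close to `ν`, which a
comparison with the centred Gaussian would not give. -/
lemma lintegral_symmRatio_sq_le (hσ : 0 < σ) {μ ν : E d} (hμν : ‖μ‖ = ‖ν‖)
    (hν : ‖ν‖ ^ 2 ≤ 4 * σ ^ 2) :
    ∫⁻ x, symmRatio σ ν μ x ^ 2 ∂(mixture σ (symmParam ν)) ≤ ENNReal.ofReal
      (1 + 4 * (Real.cosh (‖ν‖ ^ 2 / (4 * σ ^ 2)) - Real.cosh (⟪μ, ν⟫ / (4 * σ ^ 2)))) := by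
  rw [mixture_symmParam hσ, lintegral_withDensity_eq_lintegral_mul _
    (measurable_symmLR σ ν).ennreal_ofReal ((measurable_symmRatio σ ν μ).pow_const 2)]
  set Q := centredGaussian d σ
  set g : E d → ℝ := fun x => 2 * (symmLR σ μ x * symmLR σ μ x) - 4 * (symmLR σ μ x * symmLR σ ν x)
    + 2 * (symmLR σ ν x * symmLR σ ν x) + 2 * symmLR σ μ x - symmLR σ ν x
  have hle : ∀ x, ((fun x => ENNReal.ofReal (symmLR σ ν x)) * fun x => symmRatio σ ν μ x ^ 2) x ≤
      ENNReal.ofReal (g x) := by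
    intro x
    have hp := symmLR_pos σ ν x
    rw [Pi.mul_apply, symmRatio, ← ENNReal.ofReal_pow (div_pos (symmLR_pos σ μ x) hp).le,
      ← ENNReal.ofReal_mul hp.le]
    refine ENNReal.ofReal_le_ofReal ?_
    have h2 := half_le_symmLR hν x
    rw [div_pow, mul_div_assoc', div_le_iff₀ (by positivity)]
    simp only [g]
    nlinarith [mul_nonneg hp.le (mul_nonneg (sq_nonneg (symmLR σ μ x - symmLR σ ν x))
      (sub_nonneg.2 h2))]
  have i1 := (integrable_symmLR_mul_symmLR hσ μ μ).const_mul 2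
  have i2 := (integrable_symmLR_mul_symmLR hσ μ ν).const_mul 4
  have i3 := (integrable_symmLR_mul_symmLR hσ ν ν).const_mul 2
  have i4 := (integrable_symmLR hσ μ).const_mul 2
  have i5 := integrable_symmLR hσ ν
  have j2 : Integrable (fun x => 2 * (symmLR σ μ x * symmLR σ μ x) -
      4 * (symmLR σ μ x * symmLR σ ν x)) Q := i1.sub i2
  have j3 : Integrable (fun x => 2 * (symmLR σ μ x * symmLR σ μ x) -
      4 * (symmLR σ μ x * symmLR σ ν x) + 2 * (symmLR σ ν x * symmLR σ ν x)) Q := j2.add i3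
  have j4 : Integrable (fun x => 2 * (symmLR σ μ x * symmLR σ μ x) -
      4 * (symmLR σ μ x * symmLR σ ν x) + 2 * (symmLR σ ν x * symmLR σ ν x) +
      2 * symmLR σ μ x) Q := j3.add i4
  have hg : Integrable g Q := j4.sub i5
  have hg0 : ∀ x, 0 ≤ g x := fun x => by
    have h2 := half_le_symmLR hν x
    have := symmLR_pos σ μ x
    simp only [g]
    -- The function equals `2 (a - b + 1/2)² + (b - 1/2)`.
    nlinarith [sq_nonneg (symmLR σ μ x - symmLR σ ν x + 1 / 2)]
  refine (lintegral_mono hle).trans ?_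
  rw [← ofReal_integral_eq_lintegral_ofReal hg (.of_forall hg0)]
  refine ENNReal.ofReal_le_ofReal (le_of_eq ?_)
  simp only [g]
  rw [integral_sub j4 i5, integral_add j3 i4, integral_add j2 i3, integral_sub i1 i2, integral_const_mul, integral_const_mul,
    integral_const_mul, integral_const_mul, integral_symmLR_mul_symmLR hσ,
    integral_symmLR_mul_symmLR hσ, integral_symmLR_mul_symmLR hσ, integral_symmLR hσ,
    integral_symmLR hσ, real_inner_self_eq_norm_sq, real_inner_self_eq_norm_sq, hμν]
  ring

end Symm

lemma sinh_le_of_small {y : ℝ} (h0 : 0 ≤ y) (h1 : y ≤ 1 / 50) : Real.sinh y ≤ 1.01 * y := by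
  have ha := Real.abs_exp_sub_one_sub_id_le (x := y) (by rw [abs_of_nonneg h0]; linarith)
  have hb := Real.add_one_le_exp (-y)
  rw [Real.sinh_eq]
  nlinarith [(abs_le.1 ha).2]

/-- The difference is `2 sinh ((x + y)/2) sinh ((x - y)/2)`, and each factor is nearly linear on
this range. -/
lemma cosh_sub_cosh_le {x y : ℝ} (hy : 0 ≤ y) (hyx : y ≤ x) (hx : x ≤ 1 / 50) :
    Real.cosh x - Real.cosh y ≤ 0.55 * (x ^ 2 - y ^ 2) := by
  have h : Real.cosh x - Real.cosh y = 2 * (Real.sinh ((x + y) / 2) * Real.sinh ((x - y) / 2)) := by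
    have h1 := Real.cosh_add ((x + y) / 2) ((x - y) / 2)
    have h2 := Real.cosh_sub ((x + y) / 2) ((x - y) / 2)
    rw [show (x + y) / 2 + (x - y) / 2 = x by ring] at h1
    rw [show (x + y) / 2 - (x - y) / 2 = y by ring] at h2
    rw [h1, h2]; ring
  rw [h]
  have h1 := sinh_le_of_small (y := (x + y) / 2) (by linarith) (by linarith)
  have h2 := sinh_le_of_small (y := (x - y) / 2) (by linarith) (by linarith)
  have h3 : 0 ≤ Real.sinh ((x - y) / 2) := Real.sinh_nonneg_iff.2 (by linarith)
  have := mul_le_mul h1 h2 h3 (by linarith)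
  nlinarith

/-- The vector of length `lam` with one fixed coordinate `i₀` and the support pattern `ω`
of size `k` carrying the fraction `ε ^ 2` of the squared length. -/
def sparseMean {d : ℕ} (i₀ : Fin d) (k : ℕ) (lam ε : ℝ) (ω : Finset (Fin d)) : E d :=
  WithLp.toLp 2 fun i => if i = i₀ then lam * √(1 - ε ^ 2) else if i ∈ ω then lam * ε / √k else 0

/-! ### Geometry of the sparse means. -/

section SparseMean

variable {d : ℕ} {i₀ : Fin d} {k : ℕ} {lam ε : ℝ}

lemma inner_sparseMean (hk : 0 < k) (ε' : ℝ) {ω ω' : Finset (Fin d)} (hω : i₀ ∉ ω) :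
    ⟪sparseMean i₀ k lam ε ω, sparseMean i₀ k lam ε' ω'⟫ =
      lam ^ 2 * (√(1 - ε ^ 2) * √(1 - ε' ^ 2) + ε * ε' * (ω ∩ ω').card / k) := by
  have hk' : (√(k : ℝ)) ^ 2 = k := Real.sq_sqrt (Nat.cast_nonneg k)
  have hs : √(k : ℝ) ≠ 0 := by positivity
  rw [PiLp.inner_apply, ← Finset.add_sum_erase _ _ (Finset.mem_univ i₀)]
  have h : ∀ i ∈ Finset.univ.erase i₀,
      ⟪(sparseMean i₀ k lam ε ω) i, (sparseMean i₀ k lam ε' ω') i⟫ =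
        if i ∈ ω ∩ ω' then lam ^ 2 * (ε * ε' / k) else 0 := by
    intro i hi
    simp only [sparseMean, Finset.ne_of_mem_erase hi, if_false, Finset.mem_inter]
    by_cases h1 : i ∈ ω <;> by_cases h2 : i ∈ ω' <;> simp [h1, h2]
    field_simp
    rw [hk']
    ring
  rw [Finset.sum_congr rfl h, Finset.sum_ite_mem, Finset.sum_const, nsmul_eq_mul]
  have h3 : Finset.univ.erase i₀ ∩ (ω ∩ ω') = ω ∩ ω' := by
    refine Finset.inter_eq_right.2 fun i hi => ?_
    refine Finset.mem_erase.2 ⟨?_, Finset.mem_univ i⟩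
    rintro rfl
    exact hω (Finset.mem_of_mem_inter_left hi)
  rw [h3]
  simp [sparseMean]
  ring

lemma norm_sq_sparseMean (hk : 0 < k) (h0 : 0 ≤ ε) (h1 : ε ≤ 1) {ω : Finset (Fin d)}
    (hω : i₀ ∉ ω) (hc : ω.card = k) : ‖sparseMean i₀ k lam ε ω‖ ^ 2 = lam ^ 2 := by
  have hk' : (k : ℝ) ≠ 0 := by positivity
  rw [← real_inner_self_eq_norm_sq, inner_sparseMean hk ε hω, Finset.inter_self, hc,
    Real.mul_self_sqrt (by nlinarith)]
  field_simp
  ring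

lemma norm_sparseMean (hlam : 0 ≤ lam) (hk : 0 < k) (h0 : 0 ≤ ε) (h1 : ε ≤ 1)
    {ω : Finset (Fin d)} (hω : i₀ ∉ ω) (hc : ω.card = k) :
    ‖sparseMean i₀ k lam ε ω‖ = lam := by
  rw [← abs_of_nonneg hlam, ← abs_norm, ← sq_eq_sq_iff_abs_eq_abs, norm_sq_sparseMean hk h0 h1 hω hc,
    sq_abs]

lemma norm_sparseMean_zero (hlam : 0 ≤ lam) (hk : 0 < k) :
    ‖sparseMean i₀ k lam 0 ∅‖ = lam := by
  rw [← abs_of_nonneg hlam, ← abs_norm, ← sq_eq_sq_iff_abs_eq_abs, ← real_inner_self_eq_norm_sq,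
    inner_sparseMean hk 0 (Finset.notMem_empty i₀)]
  simp

lemma hammingNorm_sparseMean_le (ω : Finset (Fin d)) :
    hammingNorm (sparseMean i₀ k lam ε ω).ofLp ≤ ω.card + 1 := by
  refine le_trans (Finset.card_le_card (t := insert i₀ ω) fun i hi => ?_) (Finset.card_insert_le _ _)
  rw [Finset.mem_filter] at hi
  by_contra h
  rw [Finset.mem_insert, not_or] at h
  exact hi.2 (by simp [sparseMean, h.1, h.2])

lemma symmParam_sparseMean_mem (hlam : 0 ≤ lam) (hk : 0 < k) (h0 : 0 ≤ ε) (h1 : ε ≤ 1)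
    {ω : Finset (Fin d)} (hω : i₀ ∉ ω) (hc : ω.card = k) {s : ℕ} (hs : k + 1 ≤ s) :
    symmParam (sparseMean i₀ k lam ε ω) ∈ sparseClass d lam s := by
  have h : (symmParam (sparseMean i₀ k lam ε ω)).1 - (symmParam (sparseMean i₀ k lam ε ω)).2 =
      sparseMean i₀ k lam ε ω := by
    rw [symmParam, sub_neg_eq_add, ← add_smul]; norm_num
  refine ⟨?_, ?_⟩
  · rw [h, norm_sparseMean hlam hk h0 h1 hω hc]
  · rw [h]
    exact (hammingNorm_sparseMean_le ω).trans (by omega)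

end SparseMean

/-! ### Disagreement between Bayes rules. -/

section Bayes

variable {d : ℕ} {σ : ℝ}

lemma bayes_symmParam (hσ : 0 < σ) (μ x : E d) :
    bayes σ (symmParam μ) x = if 0 ≤ ⟪μ, x⟫ then 0 else 1 := by
  have h : gaussianDensity σ (symmParam μ).2 x ≤ gaussianDensity σ (symmParam μ).1 x ↔
      0 ≤ ⟪μ, x⟫ := by
    unfold gaussianDensity
    rw [mul_le_mul_iff_right₀ (by positivity), Real.exp_le_exp, div_le_div_iff_of_pos_right
      (by positivity), symmParam, sub_neg_eq_add, norm_add_sq_real, norm_sub_sq_real,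
      real_inner_smul_right, real_inner_comm]
    constructor <;> intro h <;> linarith
  simp only [bayes, h]

lemma measurable_bayes_symmParam (hσ : 0 < σ) (μ : E d) : Measurable (bayes σ (symmParam μ)) := by
  have : bayes σ (symmParam μ) = fun x => if 0 ≤ ⟪μ, x⟫ then 0 else 1 :=
    funext fun x => bayes_symmParam hσ μ x
  rw [this]
  exact Measurable.ite (measurableSet_le measurable_const (by fun_prop)) measurable_const
    measurable_const

/-- The signs of `⟪u, x⟫` and `⟪v, x⟫` differ when `|⟪u + v, x⟫| < |⟪u - v, x⟫|` and agree under the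
reverse strict inequality. Equal norms make `u + v` and `u - v` orthogonal, so the double-cone bound
applies with `t = ε / 3` to either labelling. -/
lemma le_centredGaussian_bayes_ne (hσ : 0 < σ) {u v : E d} {lam ε : ℝ} (hlam : 0 < lam)
    (hε0 : 0 < ε) (hε1 : ε ≤ 1) (hu : ‖u‖ = lam) (hv : ‖v‖ = lam) (huv : 0 ≤ ⟪u, v⟫)
    (hsep : lam ^ 2 * ε ^ 2 / 2 ≤ ‖u - v‖ ^ 2) (τ : Equiv.Perm (Fin 2)) :
    ENNReal.ofReal (ε / 15) ≤
      centredGaussian d σ {x | bayes σ (symmParam u) x ≠ τ (bayes σ (symmParam v) x)} := by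
  have hsub := norm_sub_sq_real u v
  have hadd := norm_add_sq_real u v
  rw [hu, hv] at hsub hadd
  have hb : u - v ≠ 0 := by
    intro h
    rw [h, norm_zero] at hsep
    have : 0 < lam ^ 2 * ε ^ 2 := by positivity
    linarith
  have ha : u + v ≠ 0 := by
    intro h
    rw [h, norm_zero] at hadd
    have : 0 < lam ^ 2 := by positivity
    linarith
  have hab : ⟪u + v, u - v⟫ = 0 := by
    rw [inner_add_left, inner_sub_right, inner_sub_right, real_inner_self_eq_norm_sq,
      real_inner_self_eq_norm_sq, hu, hv, real_inner_comm]
    ring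
  have hle1 : ε / 3 * ‖u + v‖ ≤ ‖u - v‖ := by
    refine abs_le_of_sq_le_sq' ?_ (norm_nonneg _) |>.2
    rw [mul_pow]
    have h4 : ‖u + v‖ ^ 2 ≤ 4 * lam ^ 2 := by
      have := sq_nonneg ‖u - v‖
      linarith
    nlinarith [mul_le_mul_of_nonneg_left h4 (sq_nonneg ε), mul_nonneg (sq_nonneg lam) (sq_nonneg ε)]
  have hle2 : ε / 3 * ‖u - v‖ ≤ ‖u + v‖ := by
    have : ‖u - v‖ ≤ ‖u + v‖ :=
      abs_le_of_sq_le_sq' (by linarith) (norm_nonneg _) |>.2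
    nlinarith [norm_nonneg (u - v)]
  rw [show ε / 15 = ε / 3 / 5 by ring]
  have hinner : ∀ x, ⟪u + v, x⟫ = ⟪u, x⟫ + ⟪v, x⟫ ∧ ⟪u - v, x⟫ = ⟪u, x⟫ - ⟪v, x⟫ := fun x =>
    ⟨inner_add_left _ _ _, inner_sub_left _ _ _⟩
  have hτ : τ = 1 ∨ τ = Equiv.swap 0 1 := by
    revert τ; decide
  rcases hτ with rfl | rfl
  · refine (le_centredGaussian_abs_inner_lt hσ ha hb hab (by positivity) (by linarith) hle1).trans
      (measure_mono fun x hx => ?_)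
    rw [Set.mem_ofPred_eq, ← sq_lt_sq, (hinner x).1, (hinner x).2] at hx
    have hneg : ⟪u, x⟫ * ⟪v, x⟫ < 0 := by nlinarith
    rw [Set.mem_ofPred_eq, bayes_symmParam hσ, bayes_symmParam hσ]
    rcases mul_neg_iff.1 hneg with ⟨h1, h2⟩ | ⟨h1, h2⟩
    · simp [h1.le, h2.not_ge]
    · simp [h2.le, h1.not_ge]
  · refine (le_centredGaussian_abs_inner_lt hσ hb ha (by rw [real_inner_comm, hab])
      (by positivity) (by linarith) hle2).trans (measure_mono fun x hx => ?_)
    rw [Set.mem_ofPred_eq, ← sq_lt_sq, (hinner x).1, (hinner x).2] at hx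
    have hpos : 0 < ⟪u, x⟫ * ⟪v, x⟫ := by nlinarith
    rw [Set.mem_ofPred_eq, bayes_symmParam hσ, bayes_symmParam hσ]
    rcases mul_pos_iff.1 hpos with ⟨h1, h2⟩ | ⟨h1, h2⟩
    · simp [h1.le, h2.le]
    · simp [h1.not_ge, h2.not_ge]

/-- Triangle inequality for disagreement up to relabelling. -/
lemma measure_ne_perm_le {α : Type*} [MeasurableSpace α] (Q : Measure α) (f g h : α → Fin 2)
    (τ τ' : Equiv.Perm (Fin 2)) :
    Q {x | f x ≠ (τ * τ'⁻¹) (g x)} ≤ Q {x | f x ≠ τ (h x)} + Q {x | g x ≠ τ' (h x)} := by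
  refine (measure_mono fun x hx => ?_).trans (measure_union_le _ _)
  by_contra hc
  simp only [Set.mem_union, Set.mem_ofPred_eq, not_or, not_not] at hc
  apply hx
  rw [hc.1, hc.2]
  simp

end Bayes

/-! ### Averaging over patterns and the risk bound. -/

-- If every `P i (G i)` exceeded `δ`, summing the squares would give `δ² #S ≤ C ∑ ρ (G i) ≤ C N #S`,
-- the last step by integrating the pointwise overlap bound.
open Finset in
lemma exists_measure_le_of_card_le {I β : Type*} [MeasurableSpace β] (S : Finset I)
    (hS : S.Nonempty) (P : I → Measure β) (ρ : Measure β) [IsProbabilityMeasure ρ]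
    (G : I → Set β) (hG : ∀ i ∈ S, MeasurableSet (G i)) {C N δ : ℝ≥0∞}
    (hP : ∀ i ∈ S, P i (G i) ^ 2 ≤ C * ρ (G i))
    (hcard : ∀ x, ∑ i ∈ S, (G i).indicator 1 x ≤ N * #S) (hCN : C * N < δ ^ 2) :
    ∃ i ∈ S, P i (G i) ≤ δ := by
  by_contra! h
  refine hCN.not_ge ?_
  have hS0 : (#S : ℝ≥0∞) ≠ 0 := by exact_mod_cast hS.card_pos.ne'
  rw [← ENNReal.mul_le_mul_iff_left hS0 (ENNReal.natCast_ne_top _)]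
  calc δ ^ 2 * #S = ∑ i ∈ S, δ ^ 2 := by rw [sum_const, nsmul_eq_mul, mul_comm]
    _ ≤ ∑ i ∈ S, C * ρ (G i) := sum_le_sum fun i hi =>
        (pow_le_pow_left₀ zero_le (h i hi).le 2).trans (hP i hi)
    _ = C * ∫⁻ x, ∑ i ∈ S, (G i).indicator 1 x ∂ρ := by
        rw [lintegral_finsetSum' _ fun i hi => (measurable_one.indicator (hG i hi)).aemeasurable,
          ← mul_sum]
        congr 1
        exact sum_congr rfl fun i hi => (lintegral_indicator_one (hG i hi)).symm
    _ ≤ C * ∫⁻ _, N * #S ∂ρ := by gcongr with x; exact hcard x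
    _ = C * N * #S := by simp [mul_assoc]

lemma measurableSet_near_bayes {d n : ℕ} {σ : ℝ} (hσ : 0 < σ) {F : (Fin n → E d) → E d → Fin 2}
    (hF : Measurable (Function.uncurry F)) (μ : E d) (γ : ℝ≥0∞) :
    MeasurableSet {X | ∃ τ : Equiv.Perm (Fin 2),
      centredGaussian d σ {x | bayes σ (symmParam μ) x ≠ τ (F X x)} < γ} := by
  rw [show {X | ∃ τ : Equiv.Perm (Fin 2),
      centredGaussian d σ {x | bayes σ (symmParam μ) x ≠ τ (F X x)} < γ} =
    ⋃ τ : Equiv.Perm (Fin 2), {X | centredGaussian d σ {x | bayes σ (symmParam μ) x ≠ τ (F X x)} < γ}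
    by ext; simp]
  refine MeasurableSet.iUnion fun τ => measurableSet_lt ?_ measurable_const
  have hm : MeasurableSet {p : (Fin n → E d) × E d |
      bayes σ (symmParam μ) p.2 ≠ τ (Function.uncurry F p)} := by
    refine (measurableSet_eq_fun ?_ ?_).compl
    · exact (measurable_bayes_symmParam hσ μ).comp measurable_snd
    · exact (measurable_of_countable τ).comp hF
  exact measurable_measure_prodMk_left hm

/-- Closeness is measured under the centred Gaussian, common to all `μ`, so that rules for different
patterns can be compared; passing to the mixture costs the factor `1/2`. -/
lemma le_expectedLoss_symmParam {d n : ℕ} {σ : ℝ} (hσ : 0 < σ)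
    {F : (Fin n → E d) → E d → Fin 2} (hF : Measurable (Function.uncurry F)) {μ : E d}
    (hμ : ‖μ‖ ^ 2 ≤ 4 * σ ^ 2) (γ : ℝ≥0∞) :
    ENNReal.ofReal (1 / 2) * γ * sampleLaw σ n (symmParam μ) {X | ∃ τ : Equiv.Perm (Fin 2),
      centredGaussian d σ {x | bayes σ (symmParam μ) x ≠ τ (F X x)} < γ}ᶜ ≤
      expectedLoss σ n (symmParam μ) F := by
  rw [← setLIntegral_const, expectedLoss]
  refine (setLIntegral_mono' (measurableSet_near_bayes hσ hF μ γ).compl fun X hX => ?_).trans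
    (setLIntegral_le_lintegral _ _)
  refine le_iInf fun τ => ?_
  have hX' : γ ≤ centredGaussian d σ {x | bayes σ (symmParam μ) x ≠ τ (F X x)} := by
    by_contra h
    exact hX ⟨τ, not_le.1 h⟩
  have hm : MeasurableSet {x | bayes σ (symmParam μ) x ≠ τ (F X x)} :=
    (measurableSet_eq_fun (measurable_bayes_symmParam hσ μ)
      ((measurable_of_countable τ).comp hF.of_uncurry_left)).compl
  exact (mul_le_mul_right hX' _).trans (half_mul_centredGaussian_le hσ hμ hm)

lemma sq_sampleLaw_symmParam_le {d n : ℕ} {σ : ℝ} (hσ : 0 < σ) {μ ν : E d} (hμν : ‖μ‖ = ‖ν‖)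
    (hν : ‖ν‖ ^ 2 ≤ 4 * σ ^ 2) {A : Set (Fin n → E d)} (hA : MeasurableSet A) {c : ℝ}
    (hc : 4 * (Real.cosh (‖ν‖ ^ 2 / (4 * σ ^ 2)) - Real.cosh (⟪μ, ν⟫ / (4 * σ ^ 2))) ≤ c) :
    sampleLaw σ n (symmParam μ) A ^ 2 ≤
      ENNReal.ofReal (Real.exp (n * c)) * sampleLaw σ n (symmParam ν) A := by
  have := isProbabilityMeasure_mixture_symmParam hσ μ
  have := isProbabilityMeasure_mixture_symmParam hσ ν
  have : IsProbabilityMeasure ((mixture σ (symmParam ν)).withDensity (symmRatio σ ν μ)) := by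
    rwa [mixture_withDensity_symmRatio hσ]
  have h := sq_pi_withDensity_apply_le (ι := Fin n) (mixture σ (symmParam ν)) (symmRatio σ ν μ)
    (measurable_symmRatio σ ν μ) hA
  rw [mixture_withDensity_symmRatio hσ, Fintype.card_fin] at h
  refine h.trans (mul_le_mul_left ?_ _)
  rw [Real.exp_nat_mul, ENNReal.ofReal_pow (Real.exp_pos _).le]
  refine pow_le_pow_left₀ zero_le ((lintegral_symmRatio_sq_le hσ hμν hν).trans ?_) n
  refine ENNReal.ofReal_le_ofReal ?_
  linarith [Real.add_one_le_exp c]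

lemma cosh_sub_cosh_sqrt_le {a ε : ℝ} (ha0 : 0 ≤ a) (ha : a ≤ 1 / 50) (hε0 : 0 ≤ ε)
    (hε1 : ε ≤ 1) :
    4 * (Real.cosh a - Real.cosh (a * √(1 - ε ^ 2))) ≤ 2.2 * (a ^ 2 * ε ^ 2) := by
  have h1 : 0 ≤ 1 - ε ^ 2 := by nlinarith
  have h2 : √(1 - ε ^ 2) ≤ 1 := Real.sqrt_le_one.2 (by nlinarith)
  have := cosh_sub_cosh_le (x := a) (y := a * √(1 - ε ^ 2)) (by positivity)
    (mul_le_of_le_one_right ha0 h2) ha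
  rw [mul_pow, Real.sq_sqrt h1] at this
  linarith

lemma le_mul_log_div {k m : ℕ} (hk : 4 ≤ k) (hkm : 4 * k ≤ m) :
    5.5 ≤ (k : ℝ) * Real.log (m / k) := by
  have hk' : (4 : ℝ) ≤ k := by exact_mod_cast hk
  have hk0 : (0 : ℝ) < k := by linarith
  have h4 : (4 : ℝ) ≤ m / k := by
    rw [le_div_iff₀ hk0]; exact_mod_cast hkm
  have hlog : 2 * Real.log 2 ≤ Real.log (m / k) := by
    rw [show 2 * Real.log 2 = Real.log 4 by
      rw [show (4 : ℝ) = 2 ^ 2 by norm_num, Real.log_pow]; norm_num]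
    exact Real.log_le_log (by norm_num) h4
  have := Real.log_two_gt_d9
  nlinarith

lemma ofReal_exp_mul_ofReal_exp_lt {T : ℝ} (hT : 5.5 ≤ T) :
    ENNReal.ofReal (Real.exp (T / 40)) * ENNReal.ofReal (Real.exp (-T / 4)) <
      ENNReal.ofReal 0.7 ^ 2 := by
  rw [← ENNReal.ofReal_mul (Real.exp_pos _).le, ← ENNReal.ofReal_pow (by norm_num),
    ← Real.exp_add, show T / 40 + -T / 4 = -(0.225 * T) by ring, Real.exp_neg]
  refine (ENNReal.ofReal_lt_ofReal_iff (by norm_num)).2 ?_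
  rw [inv_lt_comm₀ (Real.exp_pos _) (by norm_num)]
  refine lt_of_lt_of_le ?_ (Real.add_one_le_exp _)
  norm_num
  linarith

open Finset in
lemma sum_indicator_near_le {d n k : ℕ} {σ lam ε : ℝ} (hσ : 0 < σ) (hlam : 0 < lam) (hε0 : 0 < ε)
    (hε1 : ε ≤ 1 / 2) (hk : 0 < k) (i₀ : Fin d) (hkd : 4 * k ≤ #(univ.erase i₀))
    (F : (Fin n → E d) → E d → Fin 2) (X : Fin n → E d) :
    ∑ ω ∈ (univ.erase i₀).powersetCard k, {X | ∃ τ : Equiv.Perm (Fin 2), centredGaussian d σ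
      {x | bayes σ (symmParam (sparseMean i₀ k lam ε ω)) x ≠ τ (F X x)} <
        ENNReal.ofReal (ε / 30)}.indicator (1 : (Fin n → E d) → ℝ≥0∞) X ≤
      ENNReal.ofReal (Real.exp (-((k : ℝ) * Real.log (#(univ.erase i₀) / k)) / 4)) *
        #((univ.erase i₀).powersetCard k) := by
  classical
  set S := (univ.erase i₀).powersetCard k
  set G : Finset (Fin d) → Set (Fin n → E d) := fun ω => {X | ∃ τ : Equiv.Perm (Fin 2),
    centredGaussian d σ {x | bayes σ (symmParam (sparseMean i₀ k lam ε ω)) x ≠ τ (F X x)} <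
      ENNReal.ofReal (ε / 30)}
  have hsum : ∑ ω ∈ S, (G ω).indicator (1 : (Fin n → E d) → ℝ≥0∞) X = #{ω ∈ S | X ∈ G ω} := by
    rw [card_filter, Nat.cast_sum]
    exact sum_congr rfl fun ω _ => by by_cases h : X ∈ G ω <;> simp [h]
  change ∑ ω ∈ S, (G ω).indicator (1 : (Fin n → E d) → ℝ≥0∞) X ≤ _
  rw [hsum]
  -- Any close pattern `ω₀` serves as centre: all the others must overlap it in at least `3k/4`
  -- points.
  rcases ({ω ∈ S | X ∈ G ω}).eq_empty_or_nonempty with h0 | ⟨ω₀, h0⟩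
  · simp [h0]
  rw [mem_filter, mem_powersetCard] at h0
  obtain ⟨⟨hω₀, hc₀⟩, τ₀, hτ₀⟩ := h0
  have hi₀ : i₀ ∉ ω₀ := fun h => notMem_erase i₀ univ (hω₀ h)
  have hsub : {ω ∈ S | X ∈ G ω} ⊆ {ω ∈ S | 3 * k ≤ 4 * #(ω ∩ ω₀)} := by
    intro ω h
    rw [mem_filter] at h ⊢
    refine ⟨h.1, ?_⟩
    obtain ⟨hω, hc⟩ := mem_powersetCard.1 h.1
    obtain ⟨τ, hτ⟩ := h.2
    have hi : i₀ ∉ ω := fun h => notMem_erase i₀ univ (hω h)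
    by_contra! hlt
    have hin := inner_sparseMean (lam := lam) (ε := ε) hk ε (ω := ω) (ω' := ω₀) hi
    have hε2 : ε ^ 2 ≤ 1 / 4 := by nlinarith
    rw [Real.mul_self_sqrt (by linarith)] at hin
    have hk' : (0 : ℝ) < k := by exact_mod_cast hk
    have hr0 : 0 ≤ (#(ω ∩ ω₀) : ℝ) / k := by positivity
    have hr1 : (#(ω ∩ ω₀) : ℝ) / k ≤ 3 / 4 := by
      rw [div_le_iff₀ hk']
      have : (4 * #(ω ∩ ω₀) : ℝ) < 3 * k := by exact_mod_cast hlt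
      linarith
    have hlam2 : 0 < lam ^ 2 := by positivity
    rw [mul_div_assoc] at hin
    have hu := norm_sparseMean hlam.le hk hε0.le (by linarith) hi hc
    have hv := norm_sparseMean hlam.le hk hε0.le (by linarith) hi₀ hc₀
    have hge := le_centredGaussian_bayes_ne hσ hlam hε0 (by linarith) hu hv
      (by rw [hin]; exact mul_nonneg hlam2.le (add_nonneg (by linarith) (by positivity)))
      (by
        rw [norm_sub_sq_real, hu, hv, hin]
        -- The squared distance is `2 lam² ε² (1 - r)`, with `r ≤ 3/4` the overlap fraction.
        nlinarith [mul_le_mul_of_nonneg_left hr1 (mul_nonneg hlam2.le (sq_nonneg ε))])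
      (τ * τ₀⁻¹)
    have hle := measure_ne_perm_le (centredGaussian d σ)
      (bayes σ (symmParam (sparseMean i₀ k lam ε ω)))
      (bayes σ (symmParam (sparseMean i₀ k lam ε ω₀))) (F X) τ τ₀
    refine absurd (hge.trans hle) (not_le.2 ?_)
    calc _ < ENNReal.ofReal (ε / 30) + ENNReal.ofReal (ε / 30) := ENNReal.add_lt_add hτ hτ₀
      _ = ENNReal.ofReal (ε / 15) := by
        rw [← ENNReal.ofReal_add (by positivity) (by positivity)]; congr 1; ring
  have hcard := card_large_overlap_le (univ.erase i₀) ω₀ hω₀ (by omega) (by omega)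
  rw [hc₀] at hcard
  calc (#{ω ∈ S | X ∈ G ω} : ℝ≥0∞) ≤ #{ω ∈ S | 3 * k ≤ 4 * #(ω ∩ ω₀)} := by
        exact_mod_cast card_le_card hsub
    _ = ENNReal.ofReal (#{ω ∈ S | 3 * k ≤ 4 * #(ω ∩ ω₀)} : ℝ) := by simp
    _ ≤ ENNReal.ofReal (Real.exp (-((k : ℝ) * Real.log (#(univ.erase i₀) / k)) / 4) * #S) :=
        ENNReal.ofReal_le_ofReal hcard
    _ = _ := by rw [ENNReal.ofReal_mul (Real.exp_pos _).le, ENNReal.ofReal_natCast]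

open Finset in
lemma exists_le_expectedLoss {d n k s : ℕ} {σ lam ε : ℝ} (hσ : 0 < σ) (hlam : 0 < lam)
    (hsnr : lam / σ ≤ 0.2) (hε0 : 0 < ε) (hε1 : ε ≤ 1 / 2) (hk : 4 ≤ k) (hks : k + 1 ≤ s)
    (hkd : 4 * k ≤ d - 1) (hd : 0 < d)
    (hεn : n * (2.2 * ((lam ^ 2 / (4 * σ ^ 2)) ^ 2 * ε ^ 2)) ≤
      (k : ℝ) * Real.log ((d - 1 : ℕ) / k) / 40)
    {F : (Fin n → E d) → E d → Fin 2} (hF : Measurable (Function.uncurry F)) :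
    ∃ θ ∈ sparseClass d lam s, ENNReal.ofReal (ε / 600) ≤ expectedLoss σ n θ F := by
  have hk0 : 0 < k := by omega
  let i₀ : Fin d := ⟨0, hd⟩
  have hcd : #(univ.erase i₀) = d - 1 := by simp
  set S := (univ.erase i₀).powersetCard k
  set ν : E d := sparseMean i₀ k lam 0 ∅
  have hν : ‖ν‖ = lam := norm_sparseMean_zero hlam.le hk0
  have hlσ : lam ≤ 0.2 * σ := (div_le_iff₀ hσ).1 hsnr
  have hlσ2 : lam ^ 2 ≤ 4 * σ ^ 2 := by nlinarith
  have hi : ∀ ω ∈ S, i₀ ∉ ω := fun ω hω h =>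
    notMem_erase i₀ univ ((mem_powersetCard.1 hω).1 h)
  have hc : ∀ ω ∈ S, #ω = k := fun ω hω => (mem_powersetCard.1 hω).2
  have hnorm : ∀ ω ∈ S, ‖sparseMean i₀ k lam ε ω‖ = lam := fun ω hω =>
    norm_sparseMean hlam.le hk0 hε0.le (by linarith) (hi ω hω) (hc ω hω)
  set T : ℝ := (k : ℝ) * Real.log ((d - 1 : ℕ) / k)
  set G : Finset (Fin d) → Set (Fin n → E d) := fun ω => {X | ∃ τ : Equiv.Perm (Fin 2),
    centredGaussian d σ {x | bayes σ (symmParam (sparseMean i₀ k lam ε ω)) x ≠ τ (F X x)} <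
      ENNReal.ofReal (ε / 30)} with hG
  have hGm : ∀ ω ∈ S, MeasurableSet (G ω) := fun ω _ => measurableSet_near_bayes hσ hF _ _
  have hprob (μ : E d) : IsProbabilityMeasure (sampleLaw σ n (symmParam μ)) := by
    have := isProbabilityMeasure_mixture_symmParam hσ μ
    unfold sampleLaw
    infer_instance
  have hP : ∀ ω ∈ S, sampleLaw σ n (symmParam (sparseMean i₀ k lam ε ω)) (G ω) ^ 2 ≤
      ENNReal.ofReal (Real.exp (T / 40)) * sampleLaw σ n (symmParam ν) (G ω) := by
    intro ω hω
    have hinner : ⟪sparseMean i₀ k lam ε ω, ν⟫ / (4 * σ ^ 2) =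
        lam ^ 2 / (4 * σ ^ 2) * √(1 - ε ^ 2) := by
      rw [inner_sparseMean hk0 0 (hi ω hω)]
      simp
      ring
    refine (sq_sampleLaw_symmParam_le hσ ((hnorm ω hω).trans hν.symm) (by rwa [hν]) (hGm ω hω)
      (c := 2.2 * ((lam ^ 2 / (4 * σ ^ 2)) ^ 2 * ε ^ 2)) ?_).trans ?_
    · rw [hν, hinner]
      refine cosh_sub_cosh_sqrt_le (by positivity) ?_ hε0.le (by linarith)
      rw [div_le_iff₀ (by positivity)]
      nlinarith
    · gcongr
  have hcard : ∀ X, ∑ ω ∈ S, (G ω).indicator 1 X ≤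
      ENNReal.ofReal (Real.exp (-T / 4)) * #S := fun X => by
    have h := sum_indicator_near_le hσ hlam hε0 hε1 hk0 i₀ (by rwa [hcd]) F X
    rwa [hcd] at h
  obtain ⟨ω, hω, hle⟩ := exists_measure_le_of_card_le S
    (powersetCard_nonempty.2 (by omega)) (fun ω => sampleLaw σ n
      (symmParam (sparseMean i₀ k lam ε ω))) (sampleLaw σ n (symmParam ν)) G hGm hP hcard
    (ofReal_exp_mul_ofReal_exp_lt (le_mul_log_div hk hkd))
  refine ⟨_, symmParam_sparseMean_mem hlam.le hk0 hε0.le (by linarith) (hi ω hω) (hc ω hω) hks,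
    le_trans ?_ (le_expectedLoss_symmParam hσ hF (by rwa [hnorm ω hω]) (ENNReal.ofReal (ε / 30)))⟩
  change _ ≤ _ * sampleLaw σ n (symmParam (sparseMean i₀ k lam ε ω)) (G ω)ᶜ
  rw [prob_compl_eq_one_sub (hGm ω hω)]
  -- The right side is `ε/200`, so there is room to spare.
  calc ENNReal.ofReal (ε / 600)
      ≤ ENNReal.ofReal (1 / 2) * ENNReal.ofReal (ε / 30) * (1 - ENNReal.ofReal 0.7) := by
        rw [← ENNReal.ofReal_one, ← ENNReal.ofReal_sub _ (by norm_num),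
          ← ENNReal.ofReal_mul (by norm_num), ← ENNReal.ofReal_mul (by positivity)]
        exact ENNReal.ofReal_le_ofReal (by linarith)
    _ ≤ _ := by gcongr

end GaussMix

end

/-! ### Choice of `ε` and conclusion. -/

theorem theorem4 (d n s : ℕ) (lam σ : ℝ) (hσ : 0 < σ) (hlam : 0 < lam) (hn : 1 ≤ n)
    (hsnr : lam / σ ≤ 0.2) (hd : 17 ≤ d) (hs : 5 ≤ s)
    (hsd : (s : ℝ) ≤ ((d : ℝ) - 1) / 4 + 1) :
    ENNReal.ofReal (1 / 600 *
        min (Real.sqrt (8 / 45) * (σ ^ 2 / lam ^ 2) *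
            Real.sqrt (((s : ℝ) - 1) / (n : ℝ) * Real.log (((d : ℝ) - 1) / ((s : ℝ) - 1))))
          (1 / 2)) ≤
      GaussMix.minimaxRisk σ n (GaussMix.sparseClass d lam s) := by
  obtain ⟨k, rfl⟩ : ∃ k, s = k + 1 := ⟨s - 1, by omega⟩
  obtain ⟨m, rfl⟩ : ∃ m, d = m + 1 := ⟨d - 1, by omega⟩
  have hk : 4 ≤ k := by omega
  have hkm : 4 * k ≤ m := by
    have : (4 * k : ℝ) ≤ m := by push_cast at hsd; linarith
    exact_mod_cast this
  have hT := GaussMix.le_mul_log_div hk hkm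
  have hn0 : (0 : ℝ) < n := by exact_mod_cast hn
  push_cast
  simp only [add_sub_cancel_right]
  set ε := min (Real.sqrt (8 / 45) * (σ ^ 2 / lam ^ 2) *
    Real.sqrt ((k : ℝ) / n * Real.log (m / k))) (1 / 2) with hε
  rw [div_mul_eq_mul_div] at hε
  have hTn : 0 < (k : ℝ) * Real.log (m / k) / n := by positivity
  have hε0 : 0 < ε := by
    rw [hε]
    exact lt_min (by positivity) (by norm_num)
  have hε2 : (lam ^ 2 / σ ^ 2) ^ 2 * ε ^ 2 ≤ 8 / 45 * ((k : ℝ) * Real.log (m / k) / n) := by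
    have h : ε ≤ _ := hε.trans_le (min_le_left _ _)
    calc (lam ^ 2 / σ ^ 2) ^ 2 * ε ^ 2 ≤ (lam ^ 2 / σ ^ 2) ^ 2 * (Real.sqrt (8 / 45) *
          (σ ^ 2 / lam ^ 2) * Real.sqrt ((k : ℝ) * Real.log (m / k) / n)) ^ 2 := by gcongr
      _ = 8 / 45 * ((k : ℝ) * Real.log (m / k) / n) := by
          rw [mul_pow, mul_pow, Real.sq_sqrt (by norm_num), Real.sq_sqrt hTn.le]
          field_simp
  have hεn : n * (2.2 * ((lam ^ 2 / (4 * σ ^ 2)) ^ 2 * ε ^ 2)) ≤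
      (k : ℝ) * Real.log ((m + 1 - 1 : ℕ) / k) / 40 := by
    have h := mul_le_mul_of_nonneg_left hε2 hn0.le
    rw [show (n : ℝ) * (8 / 45 * ((k : ℝ) * Real.log (m / k) / n)) =
      8 / 45 * ((k : ℝ) * Real.log (m / k)) by field_simp] at h
    rw [Nat.add_sub_cancel, show (lam ^ 2 / (4 * σ ^ 2)) ^ 2 = (lam ^ 2 / σ ^ 2) ^ 2 / 16 by
      field_simp; norm_num]
    -- The constant `8/45` enters here: `2.2 / 16 * (8/45) ≤ 1/40`.
    linarith
  rw [one_div_mul_eq_div]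
  refine le_iInf₂ fun F hF => ?_
  obtain ⟨θ, hθ, hle⟩ := GaussMix.exists_le_expectedLoss (s := k + 1) hσ hlam hsnr hε0
    (min_le_right _ _) hk le_rfl (by omega) (by omega) hεn hF
  exact hle.trans (le_iSup₂ (f := fun θ _ => GaussMix.expectedLoss σ n θ F) θ hθ)
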